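/- Let $K$ be the field of Hahn series with value group $\mathbb{R}$ and residue field $\mathbb{F}_2$: formal series $a=\sum_{q\in\mathbb{R}}a_qt^q$ with $a_q\in\mathbb{F}_2$ whose support $\{q : a_q\neq 0\}$ is well-ordered. Let $\nu:K\to\mathbb{R}\cup\{\infty\}$ be its valuation, so that $\nu(a)$ is the least exponent in the support of $a\neq 0$ and $\nu(0)=\infty$. Let $A=\{a\in K:\nu(a)\geq 0\}$ be the Hahn ring, $I_{>1}=\{a\in K:\nu(a)>1\}$, and let $P=A/I_{>1}$ be the infinite root algebra. Put $D=\operatorname{Hom}_P(-,P)$. A $P$-module $M$ is called $\Theta$-reflexive if the evaluation map $M\to D^2M$, $m\mapsto(\alpha\mapsto\alpha(m))$, is an isomorphism; let $\mathcal{M}'$ be the full subcategory of $\mathrm{Mod}_P$ consisting of the $\Theta$-reflexive modules. An ungraded triangulation structure $(\mathcal{C},\Delta)$ for a self-injective commutative ring $R$ consists of a full additive subcategory $\mathcal{C}$ of $\mathrm{Mod}_R$ that consists solely of injective modules and contains $R$, together with a triangulation $\Delta$ of $\mathcal{C}$ (satisfying the usual axioms of a triangulated category, including the octahedral axiom) whose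 suspension functor is the identity functor of $\mathcal{C}$. **Theorem.** For every ungraded triangulation structure $(\mathcal{C},\Delta)$ for $P$, the subcategory $\mathcal{C}$ is not contained in $\mathcal{M}'$. -/

import Mathlib

open CategoryTheory CategoryTheory.Limits

/-- The field `K` of Hahn series with value group `ℝ` and residue field of order two: maps
`ℝ → ZMod 2` whose support is well-ordered, written as series `∑ a_q t^q`. -/
abbrev HahnK : Type := HahnSeries ℝ (ZMod 2)

/-- The valuation `ν : K → ℝ ∪ {∞}`: the least exponent in the support, and `∞` at `0`. -/
noncomputable abbrev hahnVal : AddValuation HahnK (WithTop ℝ) :=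
  HahnSeries.addVal ℝ (ZMod 2)

/-- The Hahn ring `A = {a ∈ K : ν a ≥ 0}`. -/
def hahnRing : Subring HahnK where
  carrier := {a | 0 ≤ hahnVal a}
  zero_mem' := by simp
  one_mem' := by simp
  add_mem' {a b} ha hb := hahnVal.map_le_add ha hb
  mul_mem' {a b} ha hb := by
    simpa only [Set.mem_ofPred_eq, AddValuation.map_mul] using add_nonneg ha hb
  neg_mem' {a} ha := by simpa only [Set.mem_ofPred_eq, AddValuation.map_neg] using ha

/-- The ideal `I_{>q} = {a : ν a > q}` of the Hahn ring. -/
def hahnIdealGT (q : ℝ) : Ideal hahnRing where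
  carrier := {a | (q : WithTop ℝ) < hahnVal (a : HahnK)}
  zero_mem' := by simp
  add_mem' {a b} ha hb := hahnVal.map_lt_add ha hb
  smul_mem' c x hx := by
    have h : hahnVal (x : HahnK) ≤ hahnVal (c : HahnK) + hahnVal (x : HahnK) :=
      le_add_of_nonneg_left c.2
    simpa only [Set.mem_ofPred_eq, smul_eq_mul, Subring.coe_mul, AddValuation.map_mul] using
      lt_of_lt_of_le hx h

/-- The infinite root algebra `P = A / I_{>1}`. -/
abbrev InfiniteRootAlgebra : Type := hahnRing ⧸ hahnIdealGT 1

/-- The full subcategory `M'` of `Mod_P` of reflexive modules: those `M` for which the evaluation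
map `M → D (D M)` is an isomorphism, where `D = Hom_P(-, P)`. -/
def thetaReflexive : ObjectProperty (ModuleCat.{0} InfiniteRootAlgebra) :=
  fun M => Module.IsReflexive InfiniteRootAlgebra M

section IdentitySuspension

universe v u

variable (C : Type u) [Category.{v} C]

/-- The shift on `C` all of whose shift functors are the identity functor. -/
abbrev identityShift : HasShift C ℤ :=
  hasShiftMk C ℤ
    { F := fun _ => 𝟭 C
      zero := Iso.refl _
      add := fun _ _ => (Functor.leftUnitor (𝟭 C)).symm }

theorem identityShift_additive [Preadditive C] (n : ℤ) :
    letI := identityShift C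
    (shiftFunctor C n).Additive :=
  inferInstanceAs (𝟭 C).Additive

/-- A triangulation of `C` whose suspension is the identity functor: a class of exact triangles
`X ⟶ Y ⟶ Z ⟶ X` satisfying the axioms of a triangulated category, the octahedral axiom included. -/
structure IdentityTriangulation [Preadditive C] [HasZeroObject C] where
  pretriangulated :
    letI := identityShift C
    haveI := identityShift_additive C
    Pretriangulated C
  isTriangulated :
    letI := identityShift C
    haveI := identityShift_additive C
    letI := pretriangulated
    IsTriangulated C

end IdentitySuspension

/-- An ungraded triangulation structure `(C, Δ)` for a commutative ring `R`. That `R` is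
self-injective follows from `self_mem` and `injective`. -/
structure UngradedTriangulationStructure (R : Type) [CommRing R] where
  /-- the objects of the full subcategory `C` of `Mod_R` -/
  obj : ObjectProperty (ModuleCat.{0} R)
  /-- `C` is additive -/
  hasZeroObject : HasZeroObject obj.FullSubcategory
  hasFiniteBiproducts : HasFiniteBiproducts obj.FullSubcategory
  /-- `C` consists of injective modules -/
  injective : ∀ M : ModuleCat.{0} R, obj M → Module.Injective R M
  /-- `C` contains `R` -/
  self_mem : obj (ModuleCat.of R R)
  /-- the triangulation `Δ` of `C`, with the identity functor as suspension -/
  triangulation : IdentityTriangulation obj.FullSubcategory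

/-! Since the suspension is the identity, the cone `Z` of multiplication by `a` on `R` sits in a
triangle `R → R → Z → R`. As `Hom(R, -)` reads off elements, `Z` has `R / a` as the submodule
generated by `g 1`, and `a` kills the quotient. If `Ann (a ^ 2) ⊆ (a)`, injectivity of `Z` gives `g
1 = a ^ 2 • y`; but `a • y` lies in `R / a`, which `a` kills, so `g 1 = 0` and `a` is a unit. In `P`
the non-unit `t ^ (1 / 3)` satisfies this condition. -/

/-- If an element `x` of an injective module is killed by the annihilator of `r`, then `x` is
divisible by `r`. -/
theorem exists_smul_eq_of_injective {R M : Type} [CommRing R] [AddCommGroup M] [Module R M]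
    (hM : Module.Injective R M) (r : R) (x : M) (h : ∀ c : R, r * c = 0 → c • x = 0) :
    ∃ y : M, r • y = x := by
  let f : R →ₗ[R] R := LinearMap.mulLeft R r
  have hle : LinearMap.ker f ≤ LinearMap.ker (LinearMap.toSpanSingleton R M x) := by
    intro c hc
    simpa [LinearMap.mem_ker] using h c (by simpa [f, LinearMap.mem_ker] using hc)
  -- Multiplication by `r` embeds `R / Ann r` in `R`; the map `c ↦ c • x` on that quotient extends
  -- along it to `k`, and `k 1` is the witness.
  obtain ⟨k, hk⟩ := hM.out ((LinearMap.ker f).liftQ f le_rfl)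
    (LinearMap.ker_eq_bot.mp (Submodule.ker_liftQ_eq_bot _ _ _ le_rfl))
    ((LinearMap.ker f).liftQ _ hle)
  have h1 := hk (Submodule.Quotient.mk 1)
  simp only [Submodule.liftQ_apply, LinearMap.toSpanSingleton_apply, one_smul] at h1
  refine ⟨k 1, ?_⟩
  rw [← h1, ← map_smul]
  simp [f]

/-- The object `R` of the triangulated category. -/
abbrev UngradedTriangulationStructure.self {R : Type} [CommRing R]
    (S : UngradedTriangulationStructure R) : S.obj.FullSubcategory :=
  ⟨ModuleCat.of R R, S.self_mem⟩

/-- The morphism out of `R` determined by an element of an object. -/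
def UngradedTriangulationStructure.ofElement {R : Type} [CommRing R]
    (S : UngradedTriangulationStructure R) {M : S.obj.FullSubcategory} (m : M.obj) :
    S.self ⟶ M :=
  ObjectProperty.homMk (ModuleCat.ofHom (LinearMap.toSpanSingleton R M.obj m))

theorem UngradedTriangulationStructure.ofElement_comp_eq_zero {R : Type} [CommRing R]
    (S : UngradedTriangulationStructure R) {M N : S.obj.FullSubcategory}
    (k : M ⟶ N) (m : M.obj) (hm : k.hom.hom m = 0) : S.ofElement m ≫ k = 0 := by
  ext : 2
  refine LinearMap.ext fun (c : R) => ?_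
  change k.hom.hom (c • m) = 0
  rw [map_smul, hm, smul_zero]

/-- The cone of multiplication by `a` on `R` is an object of the category which is an extension of
the annihilator of `a` by `R / a`. -/
theorem UngradedTriangulationStructure.exists_cone {R : Type} [CommRing R]
    (S : UngradedTriangulationStructure R) (a : R) :
    ∃ (Z : ModuleCat.{0} R) (g : R →ₗ[R] Z) (h : Z →ₗ[R] R), S.obj Z ∧
      (∀ c, g c = 0 ↔ a ∣ c) ∧ (∀ z, h z = 0 → ∃ c, g c = z) ∧ ∀ z, a * h z = 0 := by
  let _ := S.hasZeroObject
  let _ := identityShift S.obj.FullSubcategory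
  have _ := identityShift_additive S.obj.FullSubcategory
  let _ := S.triangulation.pretriangulated
  let f : S.self ⟶ S.self := S.ofElement (M := S.self) (show R from a)
  obtain ⟨Z, g, h, hT⟩ := Pretriangulated.distinguished_cocone_triangle f
  let h' : Z ⟶ S.self := h
  have hfg : f ≫ g = 0 := Pretriangulated.comp_distTriang_mor_zero₁₂ _ hT
  have hhf : h' ≫ f = 0 := Pretriangulated.comp_distTriang_mor_zero₃₁ _ hT
  refine ⟨Z.obj, g.hom.hom, h'.hom.hom, Z.property, fun c => ⟨fun hc => ?_, ?_⟩,
    fun z hz => ?_, fun z => ?_⟩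
  -- The map `R → R` given by `c` is killed by `g`, hence factors through multiplication by `a`.
  · obtain ⟨u, hu⟩ := Pretriangulated.Triangle.coyoneda_exact₂ _ hT
      (S.ofElement (M := S.self) (show R from c)) (S.ofElement_comp_eq_zero g (show R from c) hc)
    have h1 : (1 : R) * c = (show R from u.hom.hom (1 : R)) * a :=
      congrArg (fun k : S.self ⟶ S.self => k.hom.hom (1 : R)) hu
    exact ⟨u.hom.hom (1 : R), by rw [← one_mul c, h1]; exact mul_comm _ _⟩
  · rintro ⟨b, rfl⟩
    have h1 : g.hom.hom (b * a : R) = 0 :=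
      congrArg (fun k : S.self ⟶ Z => k.hom.hom (show R from b)) hfg
    rwa [mul_comm]
  · obtain ⟨u, hu⟩ := Pretriangulated.Triangle.coyoneda_exact₃ _ hT (S.ofElement z)
      (S.ofElement_comp_eq_zero h' z hz)
    have h1 : (1 : R) • z = g.hom.hom (u.hom.hom (1 : R)) :=
      congrArg (fun k : S.self ⟶ Z => k.hom.hom (1 : R)) hu
    exact ⟨u.hom.hom (1 : R), h1.symm.trans (one_smul R z)⟩
  · have h1 : (show R from h'.hom.hom z) * a = 0 := congrArg (fun k : Z ⟶ S.self => k.hom.hom z) hhf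
    exact (mul_comm _ _).trans h1

/-- If the annihilator of `a ^ 2` is contained in `(a)`, then `a` is a unit in any ring with an
ungraded triangulation structure. -/
theorem UngradedTriangulationStructure.isUnit_of_sq_mul_eq_zero {R : Type} [CommRing R]
    (S : UngradedTriangulationStructure R) (a : R)
    (ha : ∀ c : R, a ^ 2 * c = 0 → a ∣ c) : IsUnit a := by
  obtain ⟨Z, g, h, hZ, hg, hgh, hh⟩ := S.exists_cone a
  obtain ⟨y, hy⟩ := exists_smul_eq_of_injective (S.injective Z hZ) (a ^ 2) (g 1) fun c hc => by
    rw [← map_smul, smul_eq_mul, mul_one]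
    exact (hg c).2 (ha c hc)
  obtain ⟨c, hc⟩ := hgh (a • y) (by rw [map_smul, smul_eq_mul, hh])
  refine isUnit_of_dvd_one ((hg 1).1 ?_)
  rw [← hy, sq, mul_smul, ← hc, ← map_smul, smul_eq_mul, hg]
  exact dvd_mul_right a c

/-- The power `t ^ (1 / 3)` in the Hahn ring. -/
noncomputable def hahnCubeRoot : hahnRing :=
  ⟨HahnSeries.single (1 / 3 : ℝ) 1, by
    change 0 ≤ hahnVal _
    rw [HahnSeries.addVal_apply_of_ne (by simp), HahnSeries.order_single one_ne_zero]
    exact_mod_cast (by norm_num : (0 : ℝ) ≤ 1 / 3)⟩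

theorem hahnVal_hahnCubeRoot : hahnVal (hahnCubeRoot : HahnK) = ((1 / 3 : ℝ) : WithTop ℝ) := by
  rw [hahnCubeRoot, HahnSeries.addVal_apply_of_ne (by simp), HahnSeries.order_single one_ne_zero]

/-- The class is nilpotent in a nonzero ring. The fourth power is needed: the cube is `t`, which
survives because the ideal asks for `ν > 1` strictly. -/
theorem hahnCubeRoot_not_isUnit :
    ¬ IsUnit (Ideal.Quotient.mk (hahnIdealGT 1) hahnCubeRoot) := by
  intro hu
  have h4 : Ideal.Quotient.mk (hahnIdealGT 1) hahnCubeRoot ^ 4 = 0 := by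
    rw [← map_pow, Ideal.Quotient.eq_zero_iff_mem]
    change ((1 : ℝ) : WithTop ℝ) < hahnVal ((hahnCubeRoot : HahnK) ^ 4)
    rw [AddValuation.map_pow, hahnVal_hahnCubeRoot, ← WithTop.coe_nsmul, WithTop.coe_lt_coe]
    norm_num
  have h0 := hu.pow 4
  rw [h4, isUnit_zero_iff, eq_comm, ← map_one (Ideal.Quotient.mk (hahnIdealGT 1)),
    Ideal.Quotient.eq_zero_iff_mem] at h0
  change ((1 : ℝ) : WithTop ℝ) < hahnVal (1 : HahnK) at h0
  rw [AddValuation.map_one] at h0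
  exact absurd h0 (not_lt.mpr (by exact_mod_cast zero_le_one))

/-- From `2 / 3 + ν c > 1` follows `ν c > 1 / 3`, so `c / t ^ (1 / 3)` lies in the Hahn ring. For `t
^ q` the same argument needs `1 - 2 * q ≥ q`, and `1 / 3` is the extreme case. -/
theorem hahnCubeRoot_dvd_of_sq_mul_eq_zero (c : InfiniteRootAlgebra)
    (hc : Ideal.Quotient.mk (hahnIdealGT 1) hahnCubeRoot ^ 2 * c = 0) :
    Ideal.Quotient.mk (hahnIdealGT 1) hahnCubeRoot ∣ c := by
  obtain ⟨c, rfl⟩ := Ideal.Quotient.mk_surjective c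
  rw [← map_pow, ← map_mul, Ideal.Quotient.eq_zero_iff_mem] at hc
  change ((1 : ℝ) : WithTop ℝ) < hahnVal ((hahnCubeRoot : HahnK) ^ 2 * c) at hc
  rw [AddValuation.map_mul, AddValuation.map_pow, hahnVal_hahnCubeRoot, ← WithTop.coe_nsmul] at hc
  have ht : (hahnCubeRoot : HahnK) ≠ 0 := by simp [hahnCubeRoot]
  obtain ⟨d, hd⟩ : ∃ d : HahnK, (c : HahnK) = hahnCubeRoot * d :=
    ⟨(hahnCubeRoot : HahnK)⁻¹ * c, (mul_inv_cancel_left₀ ht _).symm⟩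
  have hd0 : 0 ≤ hahnVal d := by
    rw [hd, AddValuation.map_mul, hahnVal_hahnCubeRoot] at hc
    generalize hahnVal d = v at hc
    induction v with
    | top => exact le_top
    | coe v =>
      have hc' : (1 : ℝ) < 2 • (1 / 3 : ℝ) + (1 / 3 + v) := by exact_mod_cast hc
      have : (0 : ℝ) ≤ v := by norm_num at hc'; linarith
      exact_mod_cast this
  have h : c = hahnCubeRoot * ⟨d, hd0⟩ := Subtype.ext hd
  exact ⟨Ideal.Quotient.mk _ ⟨d, hd0⟩, by rw [h, map_mul]⟩

/-- Every `c` with `t ^ (2 / 3) c = 0` is a multiple of the non-unit `t ^ (1 / 3)`, so the cone of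
multiplication by `t ^ (1 / 3)` cannot be injective. Hence no category of injective modules
containing the infinite root algebra, whether or not it consists of reflexive modules, has a triangulation with identity suspension. -/
theorem mainTheorem2 (S : UngradedTriangulationStructure InfiniteRootAlgebra) :
    ¬ S.obj ≤ thetaReflexive := fun _ =>
  hahnCubeRoot_not_isUnit
    (S.isUnit_of_sq_mul_eq_zero _ hahnCubeRoot_dvd_of_sq_mul_eq_zero)
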